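/- All graphs are finite and simple. Let $G=(V,E)$ be a graph. Fix any orientation of the edges of $G$. Let $A_G$ be the real matrix with rows indexed by $E$ and columns indexed by $V\cup E$ in which, for an edge $e$ oriented from $u$ to $v$, the entry $A_G[e,y]$ is $1$ if $y=v$ or $y\neq e$ is an edge incident to $v$, is $-1$ if $y=u$ or $y\neq e$ is an edge incident to $u$, and is $0$ otherwise. Let $B_G$ be the submatrix of $A_G$ formed by the columns indexed by $E$. The permanent index $\mathrm{pind}(M)$ of a real matrix $M$ is the least integer $k\ge 0$ for which there is a square matrix $M'$ with nonzero permanent such that each column of $M'$ is a column of $M$ and each column of $M$ (columns being distinguished by their indices) is used at most $k$ times in $M'$; it is $\infty$ if no such $k$ exists. The graph $G$ is $(k,k')$-choosable if, whenever each vertex $v$ is given a set $L(v)$ of $k$ real numbers and each edge $e$ a set $L(e)$ of $k'$ real numbers, there is a map $f:V\cup E\to\mathbb{R}$ with $f(z)\in L(z)$ for all $z\in V\cup E$ such that $f(x)+\sum_{e\ni x}f(e)\neq f(y)+\sum_{e\ni y}f(e)$ for all adjacent vertices $x,y$. A unicyclic graph is a connected graph that contains exactly one cycle. **Theorem.** For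 every unicyclic graph $U$ and every orientation of its edges, $\mathrm{pind}(B_U)\le 2$, and $U$ is $(1,3)$-choosable. Hence every connected graph with $n$ vertices and $m=n$ edges is $(1,3)$-choosable. -/

import Mathlib

namespace TotalWeighting

/-- `HasPermWitness A k`: there is a square matrix with nonzero permanent, each column of which is
a column of `A` (its `i`-th column is the `c i`-th column of `A`), and in which each column of `A`
is used at most `k` times. -/
def HasPermWitness {R C : Type*} [Fintype R] [DecidableEq R] [DecidableEq C]
    (A : Matrix R C ℝ) (k : ℕ) : Prop :=
  ∃ c : R → C, (A.submatrix id c).permanent ≠ 0 ∧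
    ∀ j : C, (Finset.univ.filter fun i => c i = j).card ≤ k

/-- The permanent index of `A`: the least `k` as above (and `⊤` if there is none). -/
noncomputable def pind {R C : Type*} [Fintype R] [DecidableEq R] [DecidableEq C]
    (A : Matrix R C ℝ) : ℕ∞ :=
  ⨅ (k : ℕ) (_ : HasPermWitness A k), (k : ℕ∞)

/-- An orientation of the edges of `G`: the edge `e` is oriented from `tail e` to `head e`. -/
structure EdgeOrientation {V : Type*} (G : SimpleGraph V) where
  tail : G.edgeSet → V
  head : G.edgeSet → V
  mk_eq : ∀ e, s(tail e, head e) = (e : Sym2 V)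

section Matrices

variable {V : Type*} [DecidableEq V] {G : SimpleGraph V}

/-- The matrix `A_G`: rows are indexed by edges, columns by vertices and edges. -/
def matrixA (D : EdgeOrientation G) : Matrix G.edgeSet (V ⊕ G.edgeSet) ℝ
  | e, .inl y => if y = D.head e then 1 else if y = D.tail e then -1 else 0
  | e, .inr y =>
    if y ≠ e ∧ D.head e ∈ (y : Sym2 V) then 1
    else if y ≠ e ∧ D.tail e ∈ (y : Sym2 V) then -1
    else 0

/-- The matrix `B_G`: the columns of `A_G` that are indexed by edges. -/
def matrixB (D : EdgeOrientation G) : Matrix G.edgeSet G.edgeSet ℝ :=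
  (matrixA D).submatrix id Sum.inr

end Matrices

section Choosability

variable {V : Type*} [DecidableEq V] (G : SimpleGraph V) [Fintype G.edgeSet]

/-- The weight `s(v)` of a vertex under a total weighting `f`. -/
def vertexWeight (f : V ⊕ G.edgeSet → ℝ) (v : V) : ℝ :=
  f (.inl v) + ∑ e ∈ Finset.univ.filter (fun e : G.edgeSet => v ∈ (e : Sym2 V)), f (.inr e)

/-- A total weighting is proper if adjacent vertices have distinct weights. -/
def IsProperTotalWeighting (f : V ⊕ G.edgeSet → ℝ) : Prop :=
  ∀ u v : V, G.Adj u v → vertexWeight G f u ≠ vertexWeight G f v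

/-- Total weight `ψ`-choosability: every assignment of lists `L z` of `ψ z` real numbers admits a
proper total weighting with values in the lists. -/
def IsTotalWeightChoosable (ψ : V ⊕ G.edgeSet → ℕ) : Prop :=
  ∀ L : V ⊕ G.edgeSet → Finset ℝ, (∀ z, (L z).card = ψ z) →
    ∃ f : V ⊕ G.edgeSet → ℝ, IsProperTotalWeighting G f ∧ ∀ z, f z ∈ L z

/-- `(k, k')`-choosability: vertices get lists of size `k`, edges get lists of size `k'`. -/
def IsChoosable (k k' : ℕ) : Prop :=
  IsTotalWeightChoosable G (Sum.elim (fun _ => k) (fun _ => k'))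

end Choosability

/-- The subgraph `C` of `G` is a cycle: it is traced out by a closed walk that is a cycle. -/
def IsCycleSubgraph {V : Type*} {G : SimpleGraph V} (C : G.Subgraph) : Prop :=
  ∃ (u : V) (p : G.Walk u u), p.IsCycle ∧ p.toSubgraph = C

/-- A unicyclic graph: a connected graph that contains exactly one cycle. -/
def IsUnicyclic {V : Type*} (G : SimpleGraph V) : Prop :=
  G.Connected ∧ ∃! C : G.Subgraph, IsCycleSubgraph C

end TotalWeighting

/-!
If the product of the linear forms given by the rows of `B_G` has a monomial with all exponents at
most `2`, then the Combinatorial Nullstellensatz yields proper weightings from lists of size `3` on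
the edges. Moreover, a multiple of the coefficient of this monomial is a sum of permanents of
matrices that use each column at most twice, so one of these permanents is nonzero.

Such a monomial exists for every set of edges without an isolated edge in which each component has
at most one cycle. If all degrees are at most `2`, then each column of `B_G` has at most two nonzero
entries, and any monomial will do. Otherwise some vertex `v` is incident with a pendant edge and
with at most two edges that are not pendant. Deleting `v` leaves a smaller graph of the same kind
and some isolated edges, and up to the rows and columns of the smaller graph the matrix is block
triangular. The blocks at `v` have at most two nonzero entries in each column, unless there are
several pendant edges at `v`: their columns agree, up to the sign of each row, with a matrix with
entries `1` off the diagonal and `0` on it, so no cancellation occurs in the product.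
-/

namespace TotalWeighting

open MvPolynomial Finset

section Coefficients

variable {ι σ K : Type*} [CommSemiring K]

theorem coeff_prod_congr_of_le {r : Finset ι} {p q : ι → MvPolynomial σ K} {m : σ →₀ ℕ}
    (h : ∀ i ∈ r, ∀ n ≤ m, coeff n (p i) = coeff n (q i)) :
    coeff m (∏ i ∈ r, p i) = coeff m (∏ i ∈ r, q i) := by
  classical
  induction r using Finset.cons_induction generalizing m with
  | empty => simp
  | cons a r ha ih =>
    simp only [prod_cons, coeff_mul]
    refine sum_congr rfl fun x hx => ?_
    have hx := mem_antidiagonal.1 hx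
    congr 1
    · exact h a (mem_cons_self a r) _ (hx ▸ le_self_add)
    · exact ih fun i hi n hn => h i (mem_cons_of_mem hi) n (hn.trans (hx ▸ le_add_self))

theorem coeff_add_mul_of_isHomogeneous {p q : MvPolynomial σ K} {m n : σ →₀ ℕ}
    (hp : p.IsHomogeneous m.degree) (h : ∀ a, coeff a p ≠ 0 → a ≤ m + n → a ≤ m) :
    coeff (m + n) (p * q) = coeff m p * coeff n q := by
  classical
  rw [coeff_mul]
  refine sum_eq_single (m, n) (fun x hx hne => ?_) (by simp)
  have hx := mem_antidiagonal.1 hx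
  contrapose! hne
  have hp₁ := left_ne_zero_of_mul hne
  have hle : x.1 ≤ m := h x.1 hp₁ (hx ▸ le_self_add)
  have hdeg : x.1.degree = m.degree := not_imp_comm.1 hp.coeff_eq_zero hp₁
  obtain ⟨d, hd⟩ := exists_add_of_le hle
  have hd0 : d = 0 := by
    rw [hd, map_add] at hdeg
    exact (Finsupp.degree_eq_zero_iff d).1 (by omega)
  have h₁ : x.1 = m := by rw [hd, hd0, add_zero]
  exact Prod.ext h₁ (add_left_cancel (h₁ ▸ hx))

variable [PartialOrder K]

theorem coeff_prod_nonneg [IsOrderedRing K] {r : Finset ι} {p : ι → MvPolynomial σ K}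
    (h : ∀ i ∈ r, ∀ n, 0 ≤ coeff n (p i)) (n : σ →₀ ℕ) : 0 ≤ coeff n (∏ i ∈ r, p i) := by
  classical
  induction r using Finset.cons_induction generalizing n with
  | empty => rw [prod_empty, coeff_one]; split_ifs <;> simp
  | cons a r ha ih =>
    rw [prod_cons, coeff_mul]
    exact sum_nonneg fun x _ => mul_nonneg (h a (mem_cons_self a r) _)
      (ih (fun i hi => h i (mem_cons_of_mem hi)) _)

theorem coeff_prod_pos [IsStrictOrderedRing K] {r : Finset ι} {p : ι → MvPolynomial σ K}
    (h : ∀ i ∈ r, ∀ n, 0 ≤ coeff n (p i)) {m : ι → σ →₀ ℕ}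
    (hm : ∀ i ∈ r, 0 < coeff (m i) (p i)) :
    0 < coeff (∑ i ∈ r, m i) (∏ i ∈ r, p i) := by
  classical
  induction r using Finset.cons_induction with
  | empty => simp
  | cons a r ha ih =>
    rw [prod_cons, sum_cons, coeff_mul]
    have hr : ∀ i ∈ r, ∀ n, 0 ≤ coeff n (p i) := fun i hi => h i (mem_cons_of_mem hi)
    refine sum_pos' (fun x _ => mul_nonneg (h a (mem_cons_self a r) _) (coeff_prod_nonneg hr _))
      ⟨(m a, ∑ i ∈ r, m i), mem_antidiagonal.2 rfl, ?_⟩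
    exact mul_pos (hm a (mem_cons_self a r)) (ih hr fun i hi => hm i (mem_cons_of_mem hi))

end Coefficients

section RowForms

variable {ι κ K : Type*} [CommSemiring K]

/-- The linear form of row `i` of `M` in the variables indexed by the columns in `s`. -/
noncomputable def rowForm (M : Matrix ι κ K) (s : Finset κ) (i : ι) : MvPolynomial κ K :=
  ∑ j ∈ s, C (M i j) * X j

/-- The product of the forms of the rows in `r`, restricted to the columns in `s`, has a monomial
with all exponents at most `k`. For `k = 2` and the matrix `B_G` this is the common algebraic
source of the bound on the permanent index and of choosability. -/
def HasBoundedMonomial (M : Matrix ι κ K) (k : ℕ) (r : Finset ι) (s : Finset κ) : Prop :=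
  ∃ m : κ →₀ ℕ, (∀ j, m j ≤ k) ∧ coeff m (∏ i ∈ r, rowForm M s i) ≠ 0

variable {M : Matrix ι κ K} {k : ℕ} {r : Finset ι} {s t : Finset κ}

theorem coeff_rowForm [DecidableEq κ] (M : Matrix ι κ K) (s : Finset κ) (i : ι) (n : κ →₀ ℕ) :
    coeff n (rowForm M s i) = ∑ j ∈ s, if Finsupp.single j 1 = n then M i j else 0 := by
  simp only [rowForm, coeff_sum, coeff_C_mul, coeff_X, mul_ite, mul_one, mul_zero]

theorem rowForm_of_subset (hst : s ⊆ t) {i : ι} (h : ∀ j ∈ t, j ∉ s → M i j = 0) :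
    rowForm M t i = rowForm M s i :=
  (sum_subset hst fun j hj hjs => by rw [h j hj hjs, C_0, zero_mul]).symm

theorem isHomogeneous_prod_rowForm (M : Matrix ι κ K) (r : Finset ι) (s : Finset κ) :
    (∏ i ∈ r, rowForm M s i).IsHomogeneous #r := by
  have h := IsHomogeneous.prod r (rowForm M s) (fun _ => 1) fun i _ =>
    IsHomogeneous.sum s _ 1 fun j _ => isHomogeneous_C_mul_X (M i j) j
  simpa using h

open scoped Classical in
theorem apply_le_card_of_coeff_ne_zero {m : κ →₀ ℕ}
    (h : coeff m (∏ i ∈ r, rowForm M s i) ≠ 0) (j : κ) :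
    m j ≤ #{i ∈ r | j ∈ s ∧ M i j ≠ 0} := by
  have hform : ∀ i, degreeOf j (rowForm M s i) ≤ if j ∈ s ∧ M i j ≠ 0 then 1 else 0 := by
    intro i
    rw [degreeOf_le_iff]
    intro n hn
    rw [mem_support_iff, coeff_rowForm] at hn
    obtain ⟨l, hl, hne⟩ := exists_ne_zero_of_sum_ne_zero hn
    obtain ⟨rfl, hM⟩ := ite_ne_right_iff.1 hne
    by_cases hlj : l = j
    · subst hlj
      simp [hl, hM]
    · simp [hlj]
  calc m j ≤ degreeOf j (∏ i ∈ r, rowForm M s i) := monomial_le_degreeOf j (mem_support_iff.2 h)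
    _ ≤ ∑ i ∈ r, degreeOf j (rowForm M s i) := degreeOf_prod_le j r _
    _ ≤ ∑ i ∈ r, if j ∈ s ∧ M i j ≠ 0 then 1 else 0 := sum_le_sum fun i _ => hform i
    _ = #{i ∈ r | j ∈ s ∧ M i j ≠ 0} := (card_filter _ _).symm

theorem apply_eq_zero_of_coeff_ne_zero {m : κ →₀ ℕ}
    (h : coeff m (∏ i ∈ r, rowForm M s i) ≠ 0) {j : κ} (hj : j ∉ s) : m j = 0 := by
  simpa [hj] using apply_le_card_of_coeff_ne_zero h j

theorem coeff_prod_rowForm_of_subset (hst : s ⊆ t) {m : κ →₀ ℕ} (hm : ∀ j ∉ s, m j = 0) :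
    coeff m (∏ i ∈ r, rowForm M t i) = coeff m (∏ i ∈ r, rowForm M s i) := by
  classical
  refine coeff_prod_congr_of_le fun i _ n hn => ?_
  rw [coeff_rowForm, coeff_rowForm]
  refine (sum_subset hst fun j _ hj => if_neg ?_).symm
  rintro rfl
  have := hn j
  rw [Finsupp.single_eq_same, hm j hj] at this
  omega

theorem HasBoundedMonomial.mono (hst : s ⊆ t) (h : HasBoundedMonomial M k r s) :
    HasBoundedMonomial M k r t := by
  obtain ⟨m, hk, hm⟩ := h
  refine ⟨m, hk, ?_⟩
  rwa [coeff_prod_rowForm_of_subset hst fun j => apply_eq_zero_of_coeff_ne_zero hm]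

-- The matrix is block triangular, so the two chosen monomials arise independently of each other.
theorem HasBoundedMonomial.union [NoZeroDivisors K] [DecidableEq ι] [DecidableEq κ]
    {r₁ r₂ : Finset ι} {s₁ s₂ : Finset κ}
    (h₁ : HasBoundedMonomial M k r₁ s₁) (h₂ : HasBoundedMonomial M k r₂ s₂)
    (hr : Disjoint r₁ r₂) (hs : Disjoint s₁ s₂) (hM : ∀ i ∈ r₁, ∀ j ∈ s₂, M i j = 0) :
    HasBoundedMonomial M k (r₁ ∪ r₂) (s₁ ∪ s₂) := by
  obtain ⟨m₁, hk₁, hm₁⟩ := h₁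
  obtain ⟨m₂, hk₂, hm₂⟩ := h₂
  have hout₁ : ∀ j ∉ s₁, m₁ j = 0 := fun j => apply_eq_zero_of_coeff_ne_zero hm₁
  have hout₂ : ∀ j ∉ s₂, m₂ j = 0 := fun j => apply_eq_zero_of_coeff_ne_zero hm₂
  have hin₂ : ∀ j ∈ s₁, m₂ j = 0 := fun j hj => hout₂ j (disjoint_left.1 hs hj)
  have hrow₁ : ∏ i ∈ r₁, rowForm M (s₁ ∪ s₂) i = ∏ i ∈ r₁, rowForm M s₁ i :=
    prod_congr rfl fun i hi => rowForm_of_subset subset_union_left fun j hj hj₁ =>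
      hM i hi j ((mem_union.1 hj).resolve_left hj₁)
  refine ⟨m₁ + m₂, fun j => ?_, ?_⟩
  · by_cases hj : j ∈ s₁
    · simpa [hin₂ j hj] using hk₁ j
    · simpa [hout₁ j hj] using hk₂ j
  · have hdeg := isHomogeneous_prod_rowForm M r₁ s₁
    rw [← not_imp_comm.1 hdeg.coeff_eq_zero hm₁] at hdeg
    rw [prod_union hr, hrow₁, coeff_add_mul_of_isHomogeneous hdeg fun a ha hle j => ?_,
      coeff_prod_rowForm_of_subset subset_union_right hout₂]
    · exact mul_ne_zero hm₁ hm₂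
    · by_cases hj : j ∈ s₁
      · simpa [hin₂ j hj] using hle j
      · simp [apply_eq_zero_of_coeff_ne_zero ha hj]

open scoped Classical in
theorem hasBoundedMonomial_of_card_le [NoZeroDivisors K] [Nontrivial K]
    (hrow : ∀ i ∈ r, ∃ j ∈ s, M i j ≠ 0) (hcol : ∀ j ∈ s, #{i ∈ r | M i j ≠ 0} ≤ k) :
    HasBoundedMonomial M k r s := by
  have hprod : ∏ i ∈ r, rowForm M s i ≠ 0 := by
    refine prod_ne_zero_iff.2 fun i hi h0 => ?_
    obtain ⟨j, hj, hM⟩ := hrow i hi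
    have := congrArg (coeff (Finsupp.single j 1)) h0
    simp [coeff_rowForm, Finsupp.single_left_inj one_ne_zero, hj, hM] at this
  obtain ⟨m, hm⟩ := exists_coeff_ne_zero hprod
  refine ⟨m, fun j => ?_, hm⟩
  by_cases hj : j ∈ s
  · simpa [hj] using (apply_le_card_of_coeff_ne_zero hm j).trans
      ((card_le_card fun i => by simp +contextual).trans (hcol j hj))
  · simp [apply_eq_zero_of_coeff_ne_zero hm hj]

theorem HasBoundedMonomial.of_row_scale {ε : ι → K}
    (h : HasBoundedMonomial (.of fun i j => ε i * M i j) k r s) :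
    HasBoundedMonomial M k r s := by
  obtain ⟨m, hk, hm⟩ := h
  have hrow : ∀ i, rowForm (.of fun i j => ε i * M i j) s i = C (ε i) * rowForm M s i := by
    intro i
    simp only [rowForm, Matrix.of_apply, map_mul, mul_sum, mul_assoc]
  simp only [hrow, prod_mul_distrib, ← map_prod, coeff_C_mul] at hm
  exact ⟨m, hk, right_ne_zero_of_mul hm⟩

theorem HasBoundedMonomial.of_submatrix {κ' : Type*} {s : Finset κ'} (g : κ' ↪ κ)
    (h : HasBoundedMonomial (M.submatrix id g) k r s) : HasBoundedMonomial M k r (s.map g) := by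
  obtain ⟨m, hk, hm⟩ := h
  have hrow : ∀ i, rowForm M (s.map g) i = rename g (rowForm (M.submatrix id g) s i) := by
    intro i
    simp [rowForm]
  refine ⟨m.mapDomain g, fun j => ?_, ?_⟩
  · by_cases hj : j ∈ Set.range g
    · obtain ⟨j, rfl⟩ := hj
      rw [Finsupp.mapDomain_apply g.injective]
      exact hk j
    · rw [Finsupp.mapDomain_of_notMem_range _ _ hj]
      exact Nat.zero_le k
  · simp only [hrow]
    rwa [← map_prod, coeff_rename_mapDomain _ g.injective]

theorem hasBoundedMonomial_of_nonneg [PartialOrder K] [IsStrictOrderedRing K] [DecidableEq κ]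
    (hM : ∀ i ∈ r, ∀ j ∈ s, 0 ≤ M i j) {c : ι → κ} (hc : ∀ i ∈ r, c i ∈ s)
    (hpos : ∀ i ∈ r, 0 < M i (c i)) (hfiber : ∀ j, #{i ∈ r | c i = j} ≤ k) :
    HasBoundedMonomial M k r s := by
  have hterm : ∀ i ∈ r, ∀ n, ∀ j ∈ s, 0 ≤ if Finsupp.single j 1 = n then M i j else 0 :=
    fun i hi n j hj => by
      split_ifs
      exacts [hM i hi j hj, le_rfl]
  refine ⟨∑ i ∈ r, Finsupp.single (c i) 1, fun j => ?_, (coeff_prod_pos ?_ ?_).ne'⟩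
  · simpa [Finsupp.finsetSum_apply, Finsupp.single_apply, ← card_filter] using hfiber j
  · intro i hi n
    rw [coeff_rowForm]
    exact sum_nonneg (hterm i hi n)
  · intro i hi
    rw [coeff_rowForm]
    exact sum_pos' (hterm i hi _) ⟨c i, hc i hi, by simpa using hpos i hi⟩

theorem hasBoundedMonomial_of_forall_ne [PartialOrder K] [IsStrictOrderedRing K]
    [DecidableEq κ] {M : Matrix κ κ K} {A F : Finset κ} (hAF : Disjoint A F) (hA : 2 ≤ #A)
    (hF : #F ≤ #A) (hM : ∀ e ∈ A ∪ F, ∀ f ∈ A, M e f = if e = f then 0 else 1) :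
    HasBoundedMonomial M 2 (A ∪ F) A := by
  obtain ⟨p, hp, -⟩ := A.countable_toSet.exists_cycleOn
  have hnt : (A : Set κ).Nontrivial := one_lt_card_iff_nontrivial.1 hA
  have : Nonempty κ := hnt.nonempty.to_type
  obtain ⟨g, hgA, hg⟩ := Set.Finite.exists_injOn_of_encard_le F.finite_toSet
    (t := (A : Set κ)) (by simpa using hF)
  have hFA : ∀ e ∈ F, e ∉ A := fun e he heA => disjoint_left.1 hAF heA he
  have hne : ∀ e ∈ A ∪ F, A.piecewise p g e ∈ A ∧ e ≠ A.piecewise p g e := by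
    intro e he
    by_cases heA : e ∈ A
    · rw [piecewise_eq_of_mem _ _ _ heA]
      exact ⟨hp.1.mapsTo heA, (hp.apply_ne hnt heA).symm⟩
    · have hgeA : g e ∈ A := hgA ((mem_union.1 he).resolve_left heA)
      rw [piecewise_eq_of_notMem _ _ _ heA]
      exact ⟨hgeA, fun h => heA (h ▸ hgeA)⟩
  refine hasBoundedMonomial_of_nonneg (c := A.piecewise p g) (fun e he f hf => ?_)
    (fun e he => (hne e he).1) (fun e he => ?_) fun j => ?_
  · rw [hM e he f hf]
    split_ifs
    exacts [le_rfl, zero_le_one]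
  · rw [hM e he _ (hne e he).1, if_neg (hne e he).2]
    exact zero_lt_one
  · have hinjA : Set.InjOn (A.piecewise p g) A :=
      p.injective.injOn.congr fun e he => (piecewise_eq_of_mem A p g he).symm
    have hinjF : Set.InjOn (A.piecewise p g) F :=
      hg.congr fun e he => (piecewise_eq_of_notMem A p g (hFA e he)).symm
    have hfiber : ∀ B : Finset κ, Set.InjOn (A.piecewise p g) B →
        #{e ∈ B | A.piecewise p g e = j} ≤ 1 := by
      refine fun B hB => card_le_one.2 fun x hx y hy => ?_
      rw [mem_filter] at hx hy
      exact hB hx.1 hy.1 (hx.2.trans hy.2.symm)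
    rw [filter_union]
    exact (card_union_le _ _).trans (add_le_add (hfiber A hinjA) (hfiber F hinjF))

end RowForms

section Consequences

variable {R C K : Type*} [Fintype R] [Fintype C]

theorem coeff_prod_rowForm_univ [DecidableEq R] [DecidableEq C] [CommSemiring K]
    (M : Matrix R C K) (m : C →₀ ℕ) :
    coeff m (∏ i, rowForm M univ i) =
      ∑ c : R → C with ∑ i, Finsupp.single (c i) 1 = m, ∏ i, M i (c i) := by
  simp only [rowForm, prod_univ_sum, coeff_sum, Fintype.piFinset_univ, sum_filter]
  refine sum_congr rfl fun c _ => ?_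
  have hmon : ∏ i, (MvPolynomial.C (M i (c i)) * X (c i) : MvPolynomial C K) =
      monomial (∑ i, Finsupp.single (c i) 1) (∏ i, M i (c i)) := by
    rw [monomial_sum_index, map_prod, ← prod_mul_distrib]
    rfl
  rw [hmon, coeff_monomial]

theorem sum_permanent_submatrix [DecidableEq R] [DecidableEq C] [CommSemiring K]
    (M : Matrix R C K) (m : C →₀ ℕ) :
    ∑ c : R → C with ∑ i, Finsupp.single (c i) 1 = m, (M.submatrix id c).permanent =
      (Fintype.card R).factorial * coeff m (∏ i, rowForm M univ i) := by
  have hσ : ∀ σ : Equiv.Perm R,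
      ∑ c : R → C with ∑ i, Finsupp.single (c i) 1 = m, ∏ i, M (σ i) (c i) =
        coeff m (∏ i, rowForm M univ i) := by
    intro σ
    rw [coeff_prod_rowForm_univ]
    refine sum_equiv (σ.arrowCongr (.refl C)) (fun c => ?_) fun c _ => ?_
    · simp only [mem_filter_univ, Equiv.arrowCongr_apply, Equiv.coe_refl, Function.comp_apply, id,
        Equiv.sum_comp σ.symm fun i => (Finsupp.single (c i) 1 : C →₀ ℕ)]
    · simpa using Equiv.prod_comp σ fun i => M i (c (σ.symm i))
  simp only [Matrix.permanent, Matrix.submatrix_apply, id]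
  rw [sum_comm, sum_congr rfl fun σ _ => hσ σ, sum_const, card_univ, Fintype.card_perm,
    nsmul_eq_mul]

theorem HasBoundedMonomial.hasPermWitness [DecidableEq R] [DecidableEq C] {M : Matrix R C ℝ}
    {k : ℕ} (h : HasBoundedMonomial M k univ univ) : HasPermWitness M k := by
  obtain ⟨m, hk, hm⟩ := h
  have hsum : ∑ c : R → C with ∑ i, Finsupp.single (c i) 1 = m,
      (M.submatrix id c).permanent ≠ 0 := by
    rw [sum_permanent_submatrix]
    exact mul_ne_zero (Nat.cast_ne_zero.2 (Nat.factorial_ne_zero _)) hm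
  obtain ⟨c, hc, hperm⟩ := exists_ne_zero_of_sum_ne_zero hsum
  obtain rfl := (mem_filter.1 hc).2
  refine ⟨c, hperm, fun j => ?_⟩
  simpa [Finsupp.finsetSum_apply, Finsupp.single_apply, ← card_filter] using hk j

theorem HasBoundedMonomial.pind_le [DecidableEq R] [DecidableEq C] {M : Matrix R C ℝ}
    {k : ℕ} (h : HasBoundedMonomial M k univ univ) : pind M ≤ k :=
  iInf₂_le k h.hasPermWitness

theorem HasBoundedMonomial.exists_forall_sum_ne_zero {ι : Type*} [CommRing K] [IsDomain K]
    {M : Matrix ι C K} {k : ℕ} {r : Finset ι} {s : Finset C} (h : HasBoundedMonomial M k r s)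
    {S : C → Finset K} (hne : ∀ j, (S j).Nonempty) (hS : ∀ j ∈ s, k < #(S j)) :
    ∃ x : C → K, (∀ j, x j ∈ S j) ∧ ∀ i ∈ r, ∑ j, M i j * x j ≠ 0 := by
  obtain ⟨m, hk, hm⟩ := h
  have hlt : ∀ j, m j < #(S j) := by
    intro j
    by_cases hj : j ∈ s
    · exact (hk j).trans_lt (hS j hj)
    · rw [apply_eq_zero_of_coeff_ne_zero hm hj]
      exact (hne j).card_pos
  rw [← coeff_prod_rowForm_of_subset (subset_univ s) fun j => apply_eq_zero_of_coeff_ne_zero hm]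
    at hm
  have hhom := isHomogeneous_prod_rowForm M r univ
  have hdeg : (∏ i ∈ r, rowForm M univ i).totalDegree = m.degree :=
    (hhom.totalDegree (ne_zero_iff.2 ⟨m, hm⟩)).trans (not_imp_comm.1 hhom.coeff_eq_zero hm).symm
  obtain ⟨x, hx, heval⟩ := combinatorial_nullstellensatz_exists_eval_nonzero _ m hm hdeg S hlt
  rw [eval_prod, prod_ne_zero_iff] at heval
  exact ⟨x, hx, fun i hi => by simpa [rowForm] using heval i hi⟩

end Consequences

section Orientation

variable {V : Type*} {G : SimpleGraph V} (D : EdgeOrientation G)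

namespace EdgeOrientation

theorem mem_iff {e : G.edgeSet} {v : V} : v ∈ (e : Sym2 V) ↔ v = D.tail e ∨ v = D.head e := by
  rw [← D.mk_eq, Sym2.mem_iff]

theorem head_mem (e : G.edgeSet) : D.head e ∈ (e : Sym2 V) := D.mem_iff.2 (.inr rfl)

theorem tail_mem (e : G.edgeSet) : D.tail e ∈ (e : Sym2 V) := D.mem_iff.2 (.inl rfl)

theorem adj (e : G.edgeSet) : G.Adj (D.tail e) (D.head e) := by
  rw [← SimpleGraph.mem_edgeSet, D.mk_eq]
  exact e.2

theorem nonempty (G : SimpleGraph V) : Nonempty (EdgeOrientation G) :=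
  ⟨⟨fun e => (Quot.out (e : Sym2 V)).1, fun e => (Quot.out (e : Sym2 V)).2,
    fun e => Quot.out_eq (e : Sym2 V)⟩⟩

theorem eq_of_head_mem_of_tail_mem {e f : G.edgeSet} (hh : D.head e ∈ (f : Sym2 V))
    (ht : D.tail e ∈ (f : Sym2 V)) : f = e :=
  Subtype.ext (((Sym2.mem_and_mem_iff (D.adj e).ne).1 ⟨ht, hh⟩).trans (D.mk_eq e))

end EdgeOrientation

variable [DecidableEq V]

theorem matrixA_inl (e : G.edgeSet) (v : V) :
    matrixA D e (.inl v) = (if v = D.head e then 1 else 0) - if v = D.tail e then 1 else 0 := by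
  have h : D.head e ≠ D.tail e := (D.adj e).ne'
  simp only [matrixA]
  split_ifs <;> simp_all

theorem matrixA_inr (e f : G.edgeSet) :
    matrixA D e (.inr f) = (if D.head e ∈ (f : Sym2 V) then 1 else 0) -
      if D.tail e ∈ (f : Sym2 V) then 1 else 0 := by
  have h := D.eq_of_head_mem_of_tail_mem (e := e) (f := f)
  have hh := D.head_mem e
  have ht := D.tail_mem e
  simp only [matrixA]
  split_ifs <;> simp_all

/-- The sign with which edges meeting `e` at its end `v` enter row `e` of the matrix. -/
def endSign (v : V) (e : G.edgeSet) : ℝ := if v = D.head e then 1 else -1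

theorem matrixB_of_mem {v : V} {e f : G.edgeSet} (hef : e ≠ f) (he : v ∈ (e : Sym2 V))
    (hf : v ∈ (f : Sym2 V)) : matrixB D e f = endSign D v e := by
  have h := D.eq_of_head_mem_of_tail_mem (e := e) (f := f)
  have hne : D.tail e ≠ D.head e := (D.adj e).ne
  simp only [matrixB, Matrix.submatrix_apply, id, matrixA_inr, endSign]
  rcases D.mem_iff.1 he with rfl | rfl <;> simp_all [hef.symm]

theorem endSign_mul_self (v : V) (e : G.edgeSet) : endSign D v e * endSign D v e = 1 := by
  unfold endSign
  split_ifs <;> norm_num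

theorem matrixB_self (e : G.edgeSet) : matrixB D e e = 0 := by
  simp [matrixB, matrixA]

theorem matrixB_ne_zero_iff {e f : G.edgeSet} : matrixB D e f ≠ 0 ↔ G.lineGraph.Adj e f := by
  rw [SimpleGraph.lineGraph_adj_iff_exists]
  constructor
  · intro h
    refine ⟨fun hef => h (hef ▸ matrixB_self D e), ?_⟩
    by_contra! hv
    exact h (by simp [matrixB, matrixA, hv _ (D.head_mem e), hv _ (D.tail_mem e)])
  · rintro ⟨hef, v, he, hf⟩
    rw [matrixB_of_mem D hef he hf]
    exact left_ne_zero_of_mul_eq_one (endSign_mul_self D v e)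

theorem matrixB_eq_zero_iff {e f : G.edgeSet} : matrixB D e f = 0 ↔ ¬ G.lineGraph.Adj e f := by
  rw [← matrixB_ne_zero_iff D, not_not]

theorem sum_matrixA_mul [Fintype V] [Fintype G.edgeSet] (e : G.edgeSet) (f : V ⊕ G.edgeSet → ℝ) :
    ∑ z, matrixA D e z * f z =
      vertexWeight G f (D.head e) - vertexWeight G f (D.tail e) := by
  simp only [Fintype.sum_sum_type, matrixA_inl, matrixA_inr, sub_mul, ite_mul, one_mul, zero_mul,
    sum_sub_distrib, sum_ite_eq', mem_univ, if_true, vertexWeight, sum_filter]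
  ring

variable {D} in
theorem HasBoundedMonomial.isChoosable [Finite V] [Fintype G.edgeSet] {k : ℕ}
    (h : HasBoundedMonomial (matrixB D) k univ univ) : IsChoosable G 1 (k + 1) := by
  have := Fintype.ofFinite V
  intro L hL
  have hne : ∀ z, (L z).Nonempty := by
    rintro (v | e) <;> simp [← card_pos, hL]
  obtain ⟨f, hf, hrow⟩ := (h.of_submatrix (M := matrixA D) .inr).exists_forall_sum_ne_zero hne
    (by simp [hL])
  simp only [sum_matrixA_mul, mem_univ, forall_true_left, sub_ne_zero] at hrow
  refine ⟨f, fun u v huv => ?_, hf⟩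
  have hmk := D.mk_eq ⟨s(u, v), huv⟩
  rcases Sym2.eq_iff.1 hmk with ⟨ht, hh⟩ | ⟨ht, hh⟩
  · simpa [ht, hh] using (hrow ⟨s(u, v), huv⟩).symm
  · simpa [ht, hh] using hrow ⟨s(u, v), huv⟩

end Orientation

section EdgeSets

variable {V : Type*} {G : SimpleGraph V}

/-- Every vertex set `S` spans at most `#S` edges of `E`, i.e. every component of `E` contains at
most one cycle. -/
def IsSparse (E : Finset G.edgeSet) : Prop :=
  ∀ S : Finset V, ∀ F ⊆ E, (∀ e ∈ F, ∀ v ∈ (e : Sym2 V), v ∈ S) → #F ≤ #S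

open scoped Classical in
/-- The edges of `E` at the vertex `v`; their number is the degree of `v` in the graph `E`. -/
noncomputable def edgesAt (E : Finset G.edgeSet) (v : V) : Finset G.edgeSet :=
  {e ∈ E | v ∈ (e : Sym2 V)}

open scoped Classical in
/-- The pendant edges of `E` at `v`: those whose other end has degree one in `E`. -/
noncomputable def pendantAt (E : Finset G.edgeSet) (v : V) : Finset G.edgeSet :=
  {e ∈ edgesAt E v | ∀ w ∈ (e : Sym2 V), w ≠ v → #(edgesAt E w) = 1}

open scoped Classical in
/-- The edges of `E` at `v` that are not pendant at `v`. -/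
noncomputable def innerAt (E : Finset G.edgeSet) (v : V) : Finset G.edgeSet :=
  edgesAt E v \ pendantAt E v

open scoped Classical in
/-- The edges of `E` that avoid `v` and become isolated when `v` is deleted. -/
noncomputable def orphansAt (E : Finset G.edgeSet) (v : V) : Finset G.edgeSet :=
  {e ∈ E | v ∉ (e : Sym2 V) ∧ ∀ f ∈ E, v ∉ (f : Sym2 V) → ¬ G.lineGraph.Adj e f}

open scoped Classical in
/-- What is left of `E` when `v` is deleted together with the edges that this isolates. -/
noncomputable def remainderAt (E : Finset G.edgeSet) (v : V) : Finset G.edgeSet :=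
  {e ∈ E | v ∉ (e : Sym2 V) ∧ ∃ f ∈ E, v ∉ (f : Sym2 V) ∧ G.lineGraph.Adj e f}

variable {E F : Finset G.edgeSet} {e f : G.edgeSet} {v : V}

theorem IsSparse.mono (hE : IsSparse E) (h : F ⊆ E) : IsSparse F :=
  fun S F' hF' => hE S F' (hF'.trans h)

theorem mem_edgesAt : e ∈ edgesAt E v ↔ e ∈ E ∧ v ∈ (e : Sym2 V) := by
  classical exact mem_filter

theorem mem_pendantAt : e ∈ pendantAt E v ↔
    e ∈ edgesAt E v ∧ ∀ w ∈ (e : Sym2 V), w ≠ v → #(edgesAt E w) = 1 := by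
  classical exact mem_filter

theorem mem_innerAt : e ∈ innerAt E v ↔ e ∈ edgesAt E v ∧ e ∉ pendantAt E v := by
  classical exact mem_sdiff

theorem mem_orphansAt : e ∈ orphansAt E v ↔
    e ∈ E ∧ v ∉ (e : Sym2 V) ∧ ∀ f ∈ E, v ∉ (f : Sym2 V) → ¬ G.lineGraph.Adj e f := by
  classical exact mem_filter

theorem mem_remainderAt : e ∈ remainderAt E v ↔
    e ∈ E ∧ v ∉ (e : Sym2 V) ∧ ∃ f ∈ E, v ∉ (f : Sym2 V) ∧ G.lineGraph.Adj e f := by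
  classical exact mem_filter

theorem sum_card_edgesAt {S : Finset V} (h : ∀ e ∈ E, ∀ v ∈ (e : Sym2 V), v ∈ S) :
    ∑ v ∈ S, #(edgesAt E v) = #E * 2 := by
  classical
  have hcount := sum_card_bipartiteAbove_eq_sum_card_bipartiteBelow
    (fun (v : V) (e : G.edgeSet) => v ∈ (e : Sym2 V)) (s := S) (t := E)
  simp only [bipartiteAbove, bipartiteBelow] at hcount
  have hends : ∀ e ∈ E, #{v ∈ S | v ∈ (e : Sym2 V)} = 2 := by
    intro e he
    rw [← Sym2.card_toFinset_of_not_isDiag (e : Sym2 V) (G.not_isDiag_of_mem_edgeSet e.2)]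
    congr 1
    ext v
    simpa using h e he v
  simp only [edgesAt]
  rw [hcount, sum_congr rfl hends, sum_const, smul_eq_mul]

theorem two_le_card_edgesAt_of_mem_innerAt (hv : 2 ≤ #(edgesAt E v)) (he : e ∈ innerAt E v)
    {w : V} (hw : w ∈ (e : Sym2 V)) : 2 ≤ #(edgesAt E w) := by
  obtain ⟨heE, hep⟩ := mem_innerAt.1 he
  obtain ⟨u, hu, huv, hdeg⟩ : ∃ u ∈ (e : Sym2 V), u ≠ v ∧ #(edgesAt E u) ≠ 1 := by
    simpa [mem_pendantAt, heE] using hep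
  have hpos : 0 < #(edgesAt E u) := card_pos.2 ⟨e, mem_edgesAt.2 ⟨(mem_edgesAt.1 heE).1, hu⟩⟩
  have huv' := (Sym2.mem_and_mem_iff huv).1 ⟨hu, (mem_edgesAt.1 heE).2⟩
  rw [huv', Sym2.mem_iff] at hw
  rcases hw with rfl | rfl
  exacts [by omega, hv]

-- Otherwise the edges with both ends of degree at least two form a graph of minimum degree two
-- with some vertex of larger degree, which has more edges than vertices.
theorem IsSparse.card_edgesAt_le_two_or_exists_pendantAt [Finite V] (hE : IsSparse E) :
    (∀ v, #(edgesAt E v) ≤ 2) ∨ ∃ v, (pendantAt E v).Nonempty ∧ #(innerAt E v) ≤ 2 := by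
  classical
  have := Fintype.ofFinite V
  by_contra! hcon
  obtain ⟨⟨v₀, hv₀⟩, hcon⟩ := hcon
  set H : Finset V := {v | 2 ≤ #(edgesAt E v)} with hH
  set EH : Finset G.edgeSet := {e ∈ E | ∀ v ∈ (e : Sym2 V), v ∈ H}
  have hmem : ∀ v, v ∈ H ↔ 2 ≤ #(edgesAt E v) := fun v => by rw [hH, mem_filter_univ]
  have hcard : #EH ≤ #H := hE H EH (filter_subset _ _) fun e he => (mem_filter.1 he).2
  have hsum : ∑ v ∈ H, #(edgesAt EH v) = #EH * 2 :=
    sum_card_edgesAt fun e he => (mem_filter.1 he).2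
  have hinner : ∀ v ∈ H, innerAt E v ⊆ edgesAt EH v := by
    intro v hv e he
    obtain ⟨heE, hve⟩ := mem_edgesAt.1 (mem_innerAt.1 he).1
    refine mem_edgesAt.2 ⟨mem_filter.2 ⟨heE, fun w hw => ?_⟩, hve⟩
    exact (hmem w).2 (two_le_card_edgesAt_of_mem_innerAt ((hmem v).1 hv) he hw)
  have hdeg : ∀ v ∈ H, min 3 (#(edgesAt E v)) ≤ #(edgesAt EH v) := by
    intro v hv
    refine le_trans ?_ (card_le_card (hinner v hv))
    rcases (pendantAt E v).eq_empty_or_nonempty with h | h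
    · simp [innerAt, h]
    · exact (min_le_left _ _).trans (hcon v h)
  have hv₀H : v₀ ∈ H := (hmem v₀).2 hv₀.le
  have hlt : ∑ _v ∈ H, 2 < ∑ v ∈ H, #(edgesAt EH v) := by
    refine sum_lt_sum (fun v hv => ?_) ⟨v₀, hv₀H, ?_⟩
    · have := hdeg v hv
      have := (hmem v).1 hv
      omega
    · have := hdeg v₀ hv₀H
      omega
  rw [hsum, sum_const, smul_eq_mul] at hlt
  omega

end EdgeSets

section Induction

variable {V : Type*} {G : SimpleGraph V} {E B : Finset G.edgeSet} {e f : G.edgeSet} {v : V}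

theorem mem_edgesAt_of_adj_pendantAt (he : e ∈ pendantAt E v) (hf : f ∈ E)
    (hef : G.lineGraph.Adj e f) : f ∈ edgesAt E v := by
  obtain ⟨hne, w, hwe, hwf⟩ := SimpleGraph.lineGraph_adj_iff_exists.1 hef
  obtain ⟨heE, hdeg⟩ := mem_pendantAt.1 he
  by_cases hwv : w = v
  · exact mem_edgesAt.2 ⟨hf, hwv ▸ hwf⟩
  · have hle := card_le_one.1 (hdeg w hwe hwv).le
    have heq := hle e (mem_edgesAt.2 ⟨(mem_edgesAt.1 heE).1, hwe⟩) f (mem_edgesAt.2 ⟨hf, hwf⟩)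
    exact absurd heq hne

theorem lineGraph_adj_of_mem_edgesAt (he : e ∈ edgesAt E v) (hf : f ∈ edgesAt E v)
    (hef : e ≠ f) : G.lineGraph.Adj e f :=
  SimpleGraph.lineGraph_adj_iff_exists.2 ⟨hef, v, (mem_edgesAt.1 he).2, (mem_edgesAt.1 hf).2⟩

theorem edgesAt_subset : edgesAt E v ⊆ E := fun _ he => (mem_edgesAt.1 he).1

theorem pendantAt_subset : pendantAt E v ⊆ edgesAt E v := fun _ he => (mem_pendantAt.1 he).1

theorem innerAt_subset : innerAt E v ⊆ edgesAt E v := fun _ he => (mem_innerAt.1 he).1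

theorem remainderAt_subset : remainderAt E v ⊆ E := fun _ he => (mem_remainderAt.1 he).1

theorem disjoint_pendantAt_innerAt : Disjoint (pendantAt E v) (innerAt E v) :=
  disjoint_right.2 fun _ he => (mem_innerAt.1 he).2

theorem not_adj_of_mem_pendantAt (he : e ∈ pendantAt E v) (hf : f ∈ E) (hvf : v ∉ (f : Sym2 V)) :
    ¬ G.lineGraph.Adj e f :=
  fun hef => hvf (mem_edgesAt.1 (mem_edgesAt_of_adj_pendantAt he hf hef)).2

theorem exists_adj_mem_innerAt_of_mem_orphansAt (hiso : ∀ e ∈ E, ∃ f ∈ E, G.lineGraph.Adj e f)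
    (he : e ∈ orphansAt E v) : ∃ f ∈ innerAt E v, G.lineGraph.Adj e f := by
  obtain ⟨heE, hve, hnadj⟩ := mem_orphansAt.1 he
  obtain ⟨f, hf, hef⟩ := hiso e heE
  have hvf : v ∈ (f : Sym2 V) := by
    by_contra hvf
    exact hnadj f hf hvf hef
  exact ⟨f, mem_innerAt.2 ⟨mem_edgesAt.2 ⟨hf, hvf⟩,
    fun hfp => not_adj_of_mem_pendantAt hfp heE hve hef.symm⟩, hef⟩

open scoped Classical in
theorem card_orphansAt_adj_le_one (hf : f ∈ edgesAt E v) :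
    #{e ∈ orphansAt E v | G.lineGraph.Adj e f} ≤ 1 := by
  have hshared : ∀ e ∈ orphansAt E v, G.lineGraph.Adj e f →
      ∃ w ∈ (e : Sym2 V), (f : Sym2 V) = s(v, w) := by
    intro e he hef
    obtain ⟨-, w, hwe, hwf⟩ := SimpleGraph.lineGraph_adj_iff_exists.1 hef
    have hvw : v ≠ w := fun hvw => (mem_orphansAt.1 he).2.1 (hvw ▸ hwe)
    exact ⟨w, hwe, (Sym2.mem_and_mem_iff hvw).1 ⟨(mem_edgesAt.1 hf).2, hwf⟩⟩
  refine card_le_one.2 fun e he e' he' => ?_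
  obtain ⟨he, hef⟩ := mem_filter.1 he
  obtain ⟨he', hef'⟩ := mem_filter.1 he'
  obtain ⟨w, hwe, hfw⟩ := hshared e he hef
  obtain ⟨w', hwe', hfw'⟩ := hshared e' he' hef'
  obtain rfl : w = w' := Sym2.congr_right.1 (hfw.symm.trans hfw')
  obtain ⟨heE', hve', -⟩ := mem_orphansAt.1 he'
  by_contra hne
  exact (mem_orphansAt.1 he).2.2 e' heE' hve'
    (SimpleGraph.lineGraph_adj_iff_exists.2 ⟨hne, w, hwe, hwe'⟩)

theorem exists_adj_of_mem_remainderAt (he : e ∈ remainderAt E v) :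
    ∃ f ∈ remainderAt E v, G.lineGraph.Adj e f := by
  obtain ⟨heE, hve, f, hf, hvf, hef⟩ := mem_remainderAt.1 he
  exact ⟨f, mem_remainderAt.2 ⟨hf, hvf, e, heE, hve, hef.symm⟩, hef⟩

variable [DecidableEq V] (D : EdgeOrientation G) {k : ℕ}

theorem hasBoundedMonomial_matrixB_of_forall_card_edgesAt_le_two
    (hiso : ∀ e ∈ E, ∃ f ∈ E, G.lineGraph.Adj e f) (hdeg : ∀ v, #(edgesAt E v) ≤ 2) :
    HasBoundedMonomial (matrixB D) 2 E E := by
  classical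
  refine hasBoundedMonomial_of_card_le (by simpa only [matrixB_ne_zero_iff] using hiso)
    fun f hf => ?_
  have hsub : {e ∈ E | matrixB D e f ≠ 0} ⊆
      (edgesAt E (D.tail f)).erase f ∪ (edgesAt E (D.head f)).erase f := by
    intro e he
    obtain ⟨heE, hef⟩ := mem_filter.1 he
    obtain ⟨hne, v, hve, hvf⟩ :=
      SimpleGraph.lineGraph_adj_iff_exists.1 ((matrixB_ne_zero_iff D).1 hef)
    rw [mem_union, mem_erase, mem_erase, mem_edgesAt, mem_edgesAt]
    rcases D.mem_iff.1 hvf with rfl | rfl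
    exacts [.inl ⟨hne, heE, hve⟩, .inr ⟨hne, heE, hve⟩]
  have htail := card_erase_of_mem (mem_edgesAt.2 ⟨hf, D.tail_mem f⟩)
  have hhead := card_erase_of_mem (mem_edgesAt.2 ⟨hf, D.head_mem f⟩)
  have := hdeg (D.tail f)
  have := hdeg (D.head f)
  have := (card_le_card hsub).trans (card_union_le _ _)
  omega

-- The pairs (rows, columns) of the hypotheses are the diagonal blocks of a block triangular matrix.
theorem hasBoundedMonomial_matrixB_of_blocks (hB : B ⊆ pendantAt E v)
    (hzero : ∀ e ∈ B, ∀ f ∈ pendantAt E v, matrixB D e f = 0)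
    (h₁ : HasBoundedMonomial (matrixB D) k (orphansAt E v ∪ B) (innerAt E v))
    (h₂ : HasBoundedMonomial (matrixB D) k (remainderAt E v) (remainderAt E v))
    (h₃ : HasBoundedMonomial (matrixB D) k (pendantAt E v \ B ∪ innerAt E v) (pendantAt E v)) :
    HasBoundedMonomial (matrixB D) k E E := by
  have hedges : ∀ e, e ∈ E ↔ e ∈ pendantAt E v ∨ e ∈ innerAt E v ∨ e ∈ orphansAt E v ∨
      e ∈ remainderAt E v := by
    intro e
    simp only [mem_innerAt, mem_orphansAt, mem_remainderAt, mem_pendantAt, mem_edgesAt]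
    grind
  have hv : ∀ e ∈ edgesAt E v, e ∉ orphansAt E v ∧ e ∉ remainderAt E v := fun e he =>
    ⟨fun h => (mem_orphansAt.1 h).2.1 (mem_edgesAt.1 he).2,
      fun h => (mem_remainderAt.1 h).2.1 (mem_edgesAt.1 he).2⟩
  have horphan : ∀ e ∈ orphansAt E v, e ∉ remainderAt E v := fun e he he' => by
    obtain ⟨-, -, f, hf, hvf, hef⟩ := mem_remainderAt.1 he'
    exact (mem_orphansAt.1 he).2.2 f hf hvf hef
  have hA := pendantAt_subset (E := E) (v := v)
  have hF := innerAt_subset (E := E) (v := v)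
  have hAF := disjoint_pendantAt_innerAt (E := E) (v := v)
  have h₁₂ := h₁.union h₂ (by grind [disjoint_left]) (by grind [disjoint_left]) (by
    simp only [matrixB_eq_zero_iff]
    intro e he f hf
    obtain ⟨hfE, hvf, -⟩ := mem_remainderAt.1 hf
    rcases mem_union.1 he with he | he
    · exact (mem_orphansAt.1 he).2.2 f hfE hvf
    · exact not_adj_of_mem_pendantAt (hB he) hfE hvf)
  have h := h₁₂.union h₃ (by grind [disjoint_left]) (by grind [disjoint_left]) (by
    intro e he f hf
    by_cases heB : e ∈ B
    · exact hzero e heB f hf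
    · have he' : e ∈ E ∧ v ∉ (e : Sym2 V) := by grind [mem_orphansAt, mem_remainderAt]
      exact (matrixB_eq_zero_iff D).2 fun hef => not_adj_of_mem_pendantAt hf he'.1 he'.2 hef.symm)
  have hrows : orphansAt E v ∪ B ∪ remainderAt E v ∪ (pendantAt E v \ B ∪ innerAt E v) = E := by
    grind
  rw [hrows] at h
  exact h.mono (by grind)

theorem hasBoundedMonomial_matrixB_of_two_le_card_pendantAt (hA : 2 ≤ #(pendantAt E v))
    (hF : #(innerAt E v) ≤ 2) (hiso : ∀ e ∈ E, ∃ f ∈ E, G.lineGraph.Adj e f)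
    (h : HasBoundedMonomial (matrixB D) 2 (remainderAt E v) (remainderAt E v)) :
    HasBoundedMonomial (matrixB D) 2 E E := by
  classical
  refine hasBoundedMonomial_matrixB_of_blocks D (B := ∅) (v := v) (empty_subset _) (by simp) ?_ h ?_
  · rw [union_empty]
    refine hasBoundedMonomial_of_card_le (fun e he => ?_) fun f hf => ?_
    · simpa only [matrixB_ne_zero_iff] using exists_adj_mem_innerAt_of_mem_orphansAt hiso he
    · simp only [matrixB_ne_zero_iff]
      exact (card_orphansAt_adj_le_one (innerAt_subset hf)).trans one_le_two
  · rw [sdiff_empty]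
    refine .of_row_scale (ε := endSign D v) ?_
    refine hasBoundedMonomial_of_forall_ne disjoint_pendantAt_innerAt hA (hF.trans hA) ?_
    intro e he f hf
    have he' := (mem_edgesAt.1 (union_subset pendantAt_subset innerAt_subset he)).2
    have hf' := (mem_edgesAt.1 (pendantAt_subset hf)).2
    rw [Matrix.of_apply]
    split_ifs with hef
    · rw [hef, matrixB_self, mul_zero]
    · rw [matrixB_of_mem D hef he' hf', endSign_mul_self]

theorem hasBoundedMonomial_matrixB_of_card_pendantAt_eq_one (hA : #(pendantAt E v) = 1)
    (hF : #(innerAt E v) ≤ 2) (hiso : ∀ e ∈ E, ∃ f ∈ E, G.lineGraph.Adj e f)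
    (h : HasBoundedMonomial (matrixB D) 2 (remainderAt E v) (remainderAt E v)) :
    HasBoundedMonomial (matrixB D) 2 E E := by
  classical
  obtain ⟨a, ha⟩ := card_eq_one.1 hA
  have haE : a ∈ edgesAt E v := pendantAt_subset (ha ▸ mem_singleton_self a)
  have haF : ∀ f ∈ innerAt E v, f ≠ a := by
    rintro f hf rfl
    exact (mem_innerAt.1 hf).2 (ha ▸ mem_singleton_self f)
  refine hasBoundedMonomial_matrixB_of_blocks D (v := v) subset_rfl ?_ ?_ h ?_ <;> rw [ha]
  · simp [matrixB_self]
  · refine hasBoundedMonomial_of_card_le (fun e he => ?_) fun f hf => ?_ <;>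
      simp only [matrixB_ne_zero_iff]
    · rcases mem_union.1 he with he | he
      · exact exists_adj_mem_innerAt_of_mem_orphansAt hiso he
      · obtain rfl := mem_singleton.1 he
        obtain ⟨f, hf, hef⟩ := hiso e (edgesAt_subset haE)
        refine ⟨f, mem_innerAt.2 ⟨mem_edgesAt_of_adj_pendantAt ?_ hf hef, ?_⟩, hef⟩
        · exact ha ▸ mem_singleton_self e
        · simpa [ha] using hef.ne'
    · rw [filter_union]
      exact (card_union_le _ _).trans (add_le_add
        (card_orphansAt_adj_le_one (innerAt_subset hf)) (card_filter_le _ _))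
  · rw [sdiff_self, bot_eq_empty, empty_union]
    refine hasBoundedMonomial_of_card_le (fun f hf => ⟨a, mem_singleton_self a, ?_⟩)
      fun _ _ => (card_filter_le _ _).trans hF
    rw [matrixB_ne_zero_iff]
    exact lineGraph_adj_of_mem_edgesAt (innerAt_subset hf) haE (haF f hf)

theorem IsSparse.hasBoundedMonomial_matrixB [Finite V] (hsp : IsSparse E)
    (hiso : ∀ e ∈ E, ∃ f ∈ E, G.lineGraph.Adj e f) : HasBoundedMonomial (matrixB D) 2 E E := by
  induction E using Finset.strongInduction with
  | H E ih =>
  rcases hsp.card_edgesAt_le_two_or_exists_pendantAt with hdeg | ⟨v, ⟨a, ha⟩, hF⟩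
  · exact hasBoundedMonomial_matrixB_of_forall_card_edgesAt_le_two D hiso hdeg
  have haE := pendantAt_subset ha
  have hrest : HasBoundedMonomial (matrixB D) 2 (remainderAt E v) (remainderAt E v) := by
    have hsub : remainderAt E v ⊂ E := (ssubset_iff_of_subset remainderAt_subset).2
      ⟨a, (mem_edgesAt.1 haE).1, fun h => (mem_remainderAt.1 h).2.1 (mem_edgesAt.1 haE).2⟩
    exact ih _ hsub (hsp.mono hsub.subset) fun e => exists_adj_of_mem_remainderAt
  rcases (one_le_card.2 ⟨a, ha⟩).eq_or_lt' with hA | hA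
  · exact hasBoundedMonomial_matrixB_of_card_pendantAt_eq_one D hA hF hiso hrest
  · exact hasBoundedMonomial_matrixB_of_two_le_card_pendantAt D hA hF hiso hrest

end Induction

section Connected

variable {V : Type*} {G : SimpleGraph V}

theorem exists_adj_dist_lt (hG : G.Connected) {s v : V} (hv : v ≠ s) :
    ∃ u, G.Adj v u ∧ G.dist u s < G.dist v s := by
  obtain ⟨p, hp⟩ := hG.exists_walk_length_eq_dist v s
  cases p with
  | nil => exact absurd rfl hv
  | cons hadj q =>
    rw [SimpleGraph.Walk.length_cons] at hp
    exact ⟨_, hadj, (SimpleGraph.dist_le q).trans_lt (by omega)⟩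

-- A vertex outside `S` is sent to the first edge of a shortest path to a fixed vertex of `S`.
theorem card_compl_le_card_compl_of_connected [Fintype V] [DecidableEq V] [Fintype G.edgeSet]
    (hG : G.Connected) {S : Finset V} (hS : S.Nonempty) {F : Finset G.edgeSet}
    (hF : ∀ e ∈ F, ∀ v ∈ (e : Sym2 V), v ∈ S) : #Sᶜ ≤ #Fᶜ := by
  obtain ⟨s, hs⟩ := hS
  have hpar : ∀ v ∈ Sᶜ, ∃ u, G.Adj v u ∧ G.dist u s < G.dist v s := fun v hv =>
    exists_adj_dist_lt hG fun h => mem_compl.1 hv (h ▸ hs)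
  choose! par hadj hlt using hpar
  have hmem : ∀ v ∈ Sᶜ, s(v, par v) ∈ Fᶜ.map (.subtype _) := fun v hv =>
    mem_map.2 ⟨⟨s(v, par v), hadj v hv⟩,
      mem_compl.2 fun h => mem_compl.1 hv (hF _ h v (Sym2.mem_mk_left _ _)), rfl⟩
  have hinj : Set.InjOn (fun v => s(v, par v)) (Sᶜ : Finset V) := by
    intro v hv w hw hvw
    rcases Sym2.eq_iff.1 hvw with ⟨h, -⟩ | ⟨hvw, hwv⟩
    · exact h
    · have hv' := hlt v hv
      have hw' := hlt w hw
      rw [hwv] at hv'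
      rw [← hvw] at hw'
      exact absurd hv' hw'.asymm
  exact (card_le_card_of_injOn _ hmem hinj).trans_eq (card_map _)

theorem isSparse_univ [Fintype V] [Fintype G.edgeSet] (hG : G.Connected)
    (hm : #G.edgeFinset ≤ Fintype.card V) : IsSparse (univ : Finset G.edgeSet) := by
  classical
  intro S F _ hF
  rcases S.eq_empty_or_nonempty with rfl | hS
  · have hF0 : F = ∅ := eq_empty_of_forall_notMem fun e he =>
      notMem_empty _ (hF e he _ (Sym2.out_fst_mem _))
    rw [hF0, card_empty]
    exact zero_le
  · have hcompl := card_compl_le_card_compl_of_connected hG hS hF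
    rw [card_compl, card_compl, ← G.edgeFinset_card] at hcompl
    have hFle := (card_le_univ F).trans_eq G.edgeFinset_card.symm
    have hSle := card_le_univ S
    omega

theorem exists_lineGraph_adj_of_notMem (hG : G.Connected) {e : G.edgeSet} {w : V}
    (hw : w ∉ (e : Sym2 V)) : ∃ f, G.lineGraph.Adj e f := by
  obtain ⟨v, hv⟩ : ∃ v, v ∈ (e : Sym2 V) := ⟨_, Sym2.out_fst_mem _⟩
  obtain ⟨p⟩ := hG.preconnected v w
  obtain ⟨d, -, hfst, hsnd⟩ := p.exists_boundary_dart {x | x ∈ (e : Sym2 V)} hv hw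
  refine ⟨⟨d.edge, d.edge_mem⟩, SimpleGraph.lineGraph_adj_iff_exists.2
    ⟨?_, d.fst, hfst, Sym2.mem_mk_left _ _⟩⟩
  rintro rfl
  exact hsnd (Sym2.mem_mk_right _ _)

theorem exists_lineGraph_adj [Fintype V] [Fintype G.edgeSet] (hG : G.Connected)
    (hm : Fintype.card V ≤ #G.edgeFinset) (e : G.edgeSet) : ∃ f, G.lineGraph.Adj e f := by
  classical
  suffices h : 2 < Fintype.card V by
    obtain ⟨w, -, hw⟩ := exists_mem_notMem_of_card_lt_card
      (((e : Sym2 V).card_toFinset_of_not_isDiag (G.not_isDiag_of_mem_edgeSet e.2)).trans_lt h)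
    exact exists_lineGraph_adj_of_notMem hG (by simpa using hw)
  have hpos : 0 < Fintype.card V := have := hG.nonempty; Fintype.card_pos
  have hle := hm.trans G.card_edgeFinset_le_card_choose_two
  by_contra! hlt
  interval_cases Fintype.card V <;> simp at hle

theorem IsUnicyclic.card_edgeFinset [Fintype V] [Fintype G.edgeSet] (hG : IsUnicyclic G) :
    #G.edgeFinset = Fintype.card V := by
  classical
  obtain ⟨hconn, C, ⟨u, p, hp, hpC⟩, huniq⟩ := hG
  obtain ⟨e, he⟩ := List.exists_mem_of_ne_nil p.edges fun h =>
    hp.not_nil (SimpleGraph.Walk.edges_eq_nil.1 h)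
  have heG := p.edges_subset_edgeSet he
  have hbridge : ¬ G.IsBridge e := fun h =>
    (SimpleGraph.isBridge_iff_forall_cycle_notMem heG).1 h p hp he
  have hconn' : (G.deleteEdges {e}).Connected := by
    induction e using Sym2.ind with
    | _ x y => exact hconn.connected_delete_edge_of_not_isBridge hbridge
  have hacyc : (G.deleteEdges {e}).IsAcyclic := by
    intro x c hc
    have hle : G.deleteEdges {e} ≤ G := SimpleGraph.deleteEdges_le _
    have heq : (c.mapLe hle).toSubgraph = p.toSubgraph :=
      (huniq _ ⟨x, c.mapLe hle, hc.mapLe hle, rfl⟩).trans hpC.symm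
    have hmem : e ∈ c.edges := by
      rw [← SimpleGraph.Walk.edges_mapLe_eq_edges hle, ← SimpleGraph.Walk.mem_edges_toSubgraph,
        heq, SimpleGraph.Walk.mem_edges_toSubgraph]
      exact he
    simpa using c.edges_subset_edgeSet hmem
  have htree := (SimpleGraph.IsTree.mk hconn' hacyc).card_edgeFinset
  have herase : (G.deleteEdges {e}).edgeFinset = G.edgeFinset.erase e := by
    ext f
    simp [and_comm]
  rwa [herase, card_erase_add_one (SimpleGraph.mem_edgeFinset.2 heG)] at htree

end Connected

end TotalWeighting

theorem theorem3p2_general {V : Type*} [Finite V] [DecidableEq V] (G : SimpleGraph V)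
    [Fintype G.edgeSet] (hiso : ∀ e : G.edgeSet, ∃ f, G.lineGraph.Adj e f)
    (hsp : TotalWeighting.IsSparse (Finset.univ : Finset G.edgeSet)) :
    (∀ D : TotalWeighting.EdgeOrientation G,
      TotalWeighting.pind (TotalWeighting.matrixB D) ≤ 2) ∧
    TotalWeighting.IsChoosable G 1 3 := by
  have hmon (D : TotalWeighting.EdgeOrientation G) :
      TotalWeighting.HasBoundedMonomial (TotalWeighting.matrixB D) 2 Finset.univ Finset.univ :=
    hsp.hasBoundedMonomial_matrixB D (by simpa using hiso)
  obtain ⟨D⟩ := TotalWeighting.EdgeOrientation.nonempty G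
  exact ⟨fun D => (hmon D).pind_le, (hmon D).isChoosable⟩

theorem theorem3p2 {V : Type*} [Fintype V] [DecidableEq V] (G : SimpleGraph V)
    [DecidableRel G.Adj] :
    (TotalWeighting.IsUnicyclic G →
      (∀ D : TotalWeighting.EdgeOrientation G,
        TotalWeighting.pind (TotalWeighting.matrixB D) ≤ 2) ∧
      TotalWeighting.IsChoosable G 1 3) ∧
    (G.Connected → G.edgeFinset.card = Fintype.card V →
      TotalWeighting.IsChoosable G 1 3) := by
  have key (hG : G.Connected) (hm : G.edgeFinset.card = Fintype.card V) := theorem3p2_general G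
    (TotalWeighting.exists_lineGraph_adj hG hm.ge) (TotalWeighting.isSparse_univ hG hm.le)
  exact ⟨fun hU => key hU.1 hU.card_edgeFinset, fun hG hm => (key hG hm).2⟩
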